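/- Let $G$ be a locally compact second countable topological group, and let $\mathcal H_R,\mathcal H_S$ be separable complex Hilbert spaces with $\mathcal H_R\otimes\mathcal H_S$ their Hilbert space tensor product. A *state* is a positive trace class operator of trace one. Let $\mathcal R=(U_R,\mathsf E,\mathcal H_R)$ be a principal frame, i.e. $U_R$ is a strongly continuous unitary representation of $G$ in $\mathcal H_R$ and $\mathsf E:\mathcal B(G)\to B(\mathcal H_R)$ is a positive operator-valued measure on the Borel sets of $G$ with $\mathsf E(gX)=U_R(g)\mathsf E(X)U_R(g)^*$ for all $g\in G$, $X\in\mathcal B(G)$. Assume that $\mathcal R$ is localizable: $\|\mathsf E(X)\|=1$ for every $X\in\mathcal B(G)$ with $\mathsf E(X)\neq 0$. Let $U_S$ be a strongly continuous unitary representation of $G$ in $\mathcal H_S$, and let $(\omega_n)$ be a localizing sequence centred at the identity $e\in G$: a sequence of states on $\mathcal H_R$ such that the probability measures $X\mapsto \operatorname{tr}[\omega_n\mathsf E(X)]$ converge weakly to the Dirac measure $\delta_e$. For $A_S\in B(\mathcal H_S)$ let $$Y^{\mathcal R}(A_S)=\int_G d\mathsf E(g)\otimes U_S(g)A_SU_S(g)^*\in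 B(\mathcal H_R\otimes\mathcal H_S)$$ be its relativization, i.e. the operator determined by $$\langle x\otimes\varphi,\,Y^{\mathcal R}(A_S)(x\otimes\psi)\rangle=\int_G\langle\varphi,U_S(g)A_SU_S(g)^*\psi\rangle\,d\langle x,\mathsf E(g)x\rangle\qquad(x\in\mathcal H_R,\ \varphi,\psi\in\mathcal H_S),$$ and, for a state $\omega$ on $\mathcal H_R$, let $\Gamma_\omega:B(\mathcal H_R\otimes\mathcal H_S)\to B(\mathcal H_S)$ be the restriction map determined by $\operatorname{tr}[\rho\,\Gamma_\omega(T)]=\operatorname{tr}[(\omega\otimes\rho)T]$ for all states $\rho$ on $\mathcal H_S$. **Theorem.** For every $A_S\in B(\mathcal H_S)$ the operators $Y^{\mathcal R}(A_S)$ and $\Gamma_{\omega_n}(T)$ ($n\in\mathbb N$, $T\in B(\mathcal H_R\otimes\mathcal H_S)$) exist and are uniquely determined by these conditions, and $$\lim_{n\to\infty}\Gamma_{\omega_n}\bigl(Y^{\mathcal R}(A_S)\bigr)=A_S$$ ultraweakly, i.e. $\operatorname{tr}\bigl[T\,\Gamma_{\omega_n}(Y^{\mathcal R}(A_S))\bigr]\to\operatorname{tr}[T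 A_S]$ for every trace class operator $T$ on $\mathcal H_S$. -/

import Mathlib

open MeasureTheory Filter Topology
open scoped InnerProductSpace TensorProduct

namespace QRF

noncomputable section

section TraceClass

variable {H : Type*} [NormedAddCommGroup H] [InnerProductSpace ℂ H] [CompleteSpace H]

variable (H) in
/-- The index set of a fixed Hilbert basis of `H`. -/
def basisIndex : Set H := (exists_hilbertBasis ℂ H).choose

variable (H) in
/-- A fixed Hilbert (complete orthonormal) basis of `H`, used to compute traces. -/
def stdBasis : HilbertBasis (basisIndex H) ℂ H := (exists_hilbertBasis ℂ H).choose_spec.choose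

/-- `T` is trace class: `∑ᵢ ⟪bᵢ, |T| bᵢ⟫ < ∞`, where `|T| = (T* T)^{1/2}`
(the sum of these nonnegative terms does not depend on the basis). -/
def IsTraceClass (T : H →L[ℂ] H) : Prop :=
  Summable fun i => (⟪stdBasis H i, CFC.abs T (stdBasis H i)⟫_ℂ).re

/-- The trace `tr T = ∑ᵢ ⟪bᵢ, T bᵢ⟫`; for trace class `T` the sum converges absolutely and does
not depend on the basis. It is only applied to trace class operators. -/
def trace (T : H →L[ℂ] H) : ℂ :=
  ∑' i, ⟪stdBasis H i, T (stdBasis H i)⟫_ℂ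

/-- A (normal) state: a positive trace class operator of trace one. -/
structure IsState (ω : H →L[ℂ] H) : Prop where
  isPositive : ω.IsPositive
  isTraceClass : IsTraceClass ω
  trace_eq_one : trace ω = 1

/-- Ultraweak convergence `A n → B`: `tr[T A n] → tr[T B]` for every trace class operator `T`. -/
def UltraweakTendsto (A : ℕ → H →L[ℂ] H) (B : H →L[ℂ] H) : Prop :=
  ∀ T : H →L[ℂ] H, IsTraceClass T →
    Tendsto (fun n => trace (T ∘L A n)) atTop (𝓝 (trace (T ∘L B)))

end TraceClass

section Tensor

variable {H K : Type*} [NormedAddCommGroup H] [InnerProductSpace ℂ H]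
  [NormedAddCommGroup K] [InnerProductSpace ℂ K]

variable (H K) in
/-- The Hilbert space tensor product: the completion of the algebraic tensor product for
`⟪x ⊗ φ, y ⊗ ψ⟫ = ⟪x, y⟫ ⟪φ, ψ⟫`. -/
abbrev HilbertTensor : Type _ := UniformSpace.Completion (H ⊗[ℂ] K)

/-- The elementary tensor `x ⊗ φ` as a vector of the Hilbert space tensor product. -/
def tmul (x : H) (φ : K) : HilbertTensor H K := ((x ⊗ₜ[ℂ] φ : H ⊗[ℂ] K) : HilbertTensor H K)

/-- The bounded operator `S ⊗ T` on the Hilbert space tensor product. -/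
def tensorOp (S : H →L[ℂ] H) (T : K →L[ℂ] K) : HilbertTensor H K →L[ℂ] HilbertTensor H K :=
  (TensorProduct.mapL S T).completion

end Tensor

section POVM

/-- A positive operator-valued measure on the measurable space `Ω` with values in the bounded
operators on `H`. Only its values on measurable sets are relevant. -/
structure POVM (Ω : Type*) [MeasurableSpace Ω] (H : Type*) [NormedAddCommGroup H]
    [InnerProductSpace ℂ H] [CompleteSpace H] where
  /-- the effect of a set of outcomes -/
  effect : Set Ω → H →L[ℂ] H
  isPositive : ∀ X, MeasurableSet X → (effect X).IsPositive
  effect_univ : effect Set.univ = 1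
  hasSum_iUnion : ∀ X : ℕ → Set Ω, (∀ n, MeasurableSet (X n)) →
    Pairwise (Function.onFun Disjoint X) → ∀ x y : H,
      HasSum (fun n => ⟪x, effect (X n) y⟫_ℂ) ⟪x, effect (⋃ n, X n) y⟫_ℂ

variable {Ω : Type*} [MeasurableSpace Ω] {H : Type*} [NormedAddCommGroup H]
  [InnerProductSpace ℂ H] [CompleteSpace H]

theorem POVM.inner_effect_empty (E : POVM Ω H) (x y : H) : ⟪x, E.effect ∅ y⟫_ℂ = 0 := by
  have h := E.hasSum_iUnion (fun _ => ∅) (fun _ => MeasurableSet.empty)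
    (fun _ _ _ => by simp [Function.onFun]) x y
  simpa using (summable_const_iff (⟪x, E.effect ∅ y⟫_ℂ)).1 h.summable

/-- The positive measure `X ↦ ⟪x, E(X) x⟫`. -/
def POVM.vectorMeasure (E : POVM Ω H) (x : H) : Measure Ω :=
  Measure.ofMeasurable (fun X _ => ENNReal.ofReal (⟪x, E.effect X x⟫_ℂ).re)
    (by simp [E.inner_effect_empty])
    (fun X hX hd => by
      have h := Complex.hasSum_re (E.hasSum_iUnion X hX hd x x)
      have h0 : ∀ n, 0 ≤ (⟪x, E.effect (X n) x⟫_ℂ).re :=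
        fun n => (E.isPositive _ (hX n)).re_inner_nonneg_right x
      rw [← h.tsum_eq, ENNReal.ofReal_tsum_of_nonneg h0 h.summable])

theorem POVM.vectorMeasure_apply (E : POVM Ω H) (x : H) {X : Set Ω} (hX : MeasurableSet X) :
    E.vectorMeasure x X = ENNReal.ofReal (⟪x, E.effect X x⟫_ℂ).re :=
  Measure.ofMeasurable_apply X hX

/-- Norm-1 property: `‖E(X)‖ = 1` whenever `E(X) ≠ 0`. Such a POVM is called localizable. -/
def POVM.IsLocalizable (E : POVM Ω H) : Prop :=
  ∀ X, MeasurableSet X → E.effect X ≠ 0 → ‖E.effect X‖ = 1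

/-- `μ` is the outcome distribution of `E` in the state `ω` given by the Born rule,
`μ(X) = tr[ω E(X)]`. -/
def POVM.IsBornMeasure (E : POVM Ω H) (ω : H →L[ℂ] H) (μ : ProbabilityMeasure Ω) : Prop :=
  ∀ X, MeasurableSet X → (((μ : Measure Ω).real X : ℝ) : ℂ) = trace (ω ∘L E.effect X)

/-- A sequence of states whose outcome distributions converge weakly to the Dirac measure
at `x`. -/
def POVM.IsLocalizingSequence [TopologicalSpace Ω] [OpensMeasurableSpace Ω]
    (E : POVM Ω H) (x : Ω) (ω : ℕ → H →L[ℂ] H) : Prop :=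
  (∀ n, IsState (ω n)) ∧
    ∃ μ : ℕ → ProbabilityMeasure Ω,
      (∀ n, E.IsBornMeasure (ω n) (μ n)) ∧ Tendsto μ atTop (𝓝 (diracProba x))

end POVM

section Frames

/-- A strongly continuous unitary representation of `G` in `H`. -/
structure UnitaryRep (G : Type*) [Group G] [TopologicalSpace G] (H : Type*)
    [NormedAddCommGroup H] [InnerProductSpace ℂ H] [CompleteSpace H] where
  /-- the underlying homomorphism into the unitary group of `H` -/
  toHom : G →* unitary (H →L[ℂ] H)
  strongly_continuous : ∀ x : H, Continuous fun g => (toHom g : H →L[ℂ] H) x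

/-- The action `g.A = U(g) A U(g)*` on bounded operators. -/
def UnitaryRep.act {G : Type*} [Group G] [TopologicalSpace G] {H : Type*}
    [NormedAddCommGroup H] [InnerProductSpace ℂ H] [CompleteSpace H]
    (U : UnitaryRep G H) (g : G) (A : H →L[ℂ] H) : H →L[ℂ] H :=
  (U.toHom g : H →L[ℂ] H) ∘L A ∘L ContinuousLinearMap.adjoint (U.toHom g : H →L[ℂ] H)

/-- A quantum reference frame based on the homogeneous `G`-space `Ω`: a system of covariance,
i.e. a strongly continuous unitary representation together with a covariant POVM on the Borel
sets of `Ω`. -/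
structure Frame (G : Type*) [Group G] [TopologicalSpace G]
    (Ω : Type*) [TopologicalSpace Ω] [MeasurableSpace Ω] [BorelSpace Ω]
    [MulAction G Ω] [ContinuousSMul G Ω] [MulAction.IsPretransitive G Ω]
    (H : Type*) [NormedAddCommGroup H] [InnerProductSpace ℂ H] [CompleteSpace H] where
  /-- the unitary representation of the frame -/
  rep : UnitaryRep G H
  /-- the frame observable -/
  obs : POVM Ω H
  covariant : ∀ (g : G) (X : Set Ω), MeasurableSet X →
    obs.effect ((fun s => g • s) '' X) = rep.act g (obs.effect X)

/-- A principal frame: a frame based on `G` itself, acting by left translations. -/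
abbrev PrincipalFrame (G : Type*) [Group G] [TopologicalSpace G] [IsTopologicalGroup G]
    [MeasurableSpace G] [BorelSpace G]
    (H : Type*) [NormedAddCommGroup H] [InnerProductSpace ℂ H] [CompleteSpace H] :=
  Frame G G H

variable {G : Type*} [Group G] [TopologicalSpace G] [IsTopologicalGroup G]
  [MeasurableSpace G] [BorelSpace G]
  {HR : Type*} [NormedAddCommGroup HR] [InnerProductSpace ℂ HR] [CompleteSpace HR]
  {HS : Type*} [NormedAddCommGroup HS] [InnerProductSpace ℂ HS] [CompleteSpace HS]

/-- `Y = ∫_G dE(g) ⊗ U(g) A U(g)*`, the operator-valued integral being understood weakly: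
`⟪x ⊗ φ, Y (x ⊗ ψ)⟫ = ∫_G ⟪φ, U(g) A U(g)* ψ⟫ dμ_x(g)` with `μ_x(X) = ⟪x, E(X) x⟫`.
(By polarization in `x` this determines `Y`.) -/
def IsRelativization (R : PrincipalFrame G HR) (U : UnitaryRep G HS) (A : HS →L[ℂ] HS)
    (Y : HilbertTensor HR HS →L[ℂ] HilbertTensor HR HS) : Prop :=
  ∀ (x : HR) (φ ψ : HS),
    ⟪tmul x φ, Y (tmul x ψ)⟫_ℂ = ∫ g, ⟪φ, U.act g A ψ⟫_ℂ ∂(R.obs.vectorMeasure x)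

open Classical in
/-- The relativization map `A ↦ ∫_G dE(g) ⊗ U(g) A U(g)*`. The value `0` stands for the case
that no such operator exists, which never occurs. -/
def relativization (R : PrincipalFrame G HR) (U : UnitaryRep G HS) (A : HS →L[ℂ] HS) :
    HilbertTensor HR HS →L[ℂ] HilbertTensor HR HS :=
  if h : ∃ Y, IsRelativization R U A Y then h.choose else 0

/-- `B` is the restriction of `T` given `ω`: `tr[ρ B] = tr[(ω ⊗ ρ) T]` for all states `ρ`. -/
def IsRestriction (ω : HR →L[ℂ] HR) (T : HilbertTensor HR HS →L[ℂ] HilbertTensor HR HS)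
    (B : HS →L[ℂ] HS) : Prop :=
  ∀ ρ : HS →L[ℂ] HS, IsState ρ → trace (ρ ∘L B) = trace (tensorOp ω ρ ∘L T)

open Classical in
/-- The restriction map `Γ_ω`. The value `0` stands for the case that no operator with the
defining property exists, which never occurs when `ω` is a state. -/
def restriction (ω : HR →L[ℂ] HR) (T : HilbertTensor HR HS →L[ℂ] HilbertTensor HR HS) :
    HS →L[ℂ] HS :=
  if h : ∃ B, IsRestriction ω T B then h.choose else 0

end Frames

end

end QRF

/-!
For a state `ω` with Born distribution `μ_ω(X) = tr[ω E(X)]`, restricting the relativization of `A`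
by `ω` averages the orbit of `A`: `⟪φ, Γ_ω(Y(A)) ψ⟫ = ∫ ⟪φ, (g.A) ψ⟫ dμ_ω(g)`. The integrand is
bounded and continuous and `μ_{ω_n} → δ_e` weakly, so these matrix elements converge to
`⟪φ, A ψ⟫`. As the operators `Γ_{ω_n}(Y(A))` are bounded by `‖A‖` and trace class operators are
products of two Hilbert–Schmidt operators, weak convergence of matrix elements improves to
ultraweak convergence.

Writing `ω = X X†` with `X` Hilbert–Schmidt gives `Γ_ω` as a norm convergent partial trace. The
operator `Y(A)` is a weak limit of the integrals of simple functions, whose norms are uniformly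
bounded because `∑ Pᵢ ⊗ Aᵢ` is a compression of the block diagonal operator with blocks `1 ⊗ Aᵢ`
whenever the `Pᵢ` are positive and sum to `1`.
-/

namespace QRF

noncomputable section

open scoped InnerProduct

section HilbertBasis

variable {𝕜 ι κ : Type*} [RCLike 𝕜]
  {E F : Type*} [NormedAddCommGroup E] [InnerProductSpace 𝕜 E]
  [NormedAddCommGroup F] [InnerProductSpace 𝕜 F]

theorem hasSum_sq_norm_inner (b : HilbertBasis ι 𝕜 E) (x : E) :
    HasSum (fun i => ‖⟪b i, x⟫_𝕜‖ ^ 2) (‖x‖ ^ 2) := by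
  have h := RCLike.hasSum_re 𝕜 (b.hasSum_inner_mul_inner x x)
  simp only [inner_mul_symm_re_eq_norm, inner_self_eq_norm_sq] at h
  refine h.congr_fun fun i => ?_
  rw [norm_mul, norm_inner_symm, sq]

theorem summable_prod_sq_norm_inner_iff (c : HilbertBasis κ 𝕜 E) {v : ι → E} :
    (Summable fun p : ι × κ => ‖⟪c p.2, v p.1⟫_𝕜‖ ^ 2) ↔ Summable fun i => ‖v i‖ ^ 2 := by
  rw [summable_prod_of_nonneg fun _ => sq_nonneg _,
    and_iff_right fun i => (hasSum_sq_norm_inner c (v i)).summable]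
  simp only [(hasSum_sq_norm_inner c _).tsum_eq]

theorem summable_sq_norm_adjoint_iff [CompleteSpace E] [CompleteSpace F]
    (b : HilbertBasis ι 𝕜 E) (c : HilbertBasis κ 𝕜 F) {T : E →L[𝕜] F} :
    (Summable fun j => ‖(T†) (c j)‖ ^ 2) ↔ Summable fun i => ‖T (b i)‖ ^ 2 := by
  rw [← summable_prod_sq_norm_inner_iff b, ← summable_prod_sq_norm_inner_iff c,
    ← (Equiv.prodComm ι κ).summable_iff]
  refine summable_congr fun p => ?_
  rw [Function.comp_apply, Equiv.prodComm_apply, Prod.fst_swap, Prod.snd_swap,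
    ContinuousLinearMap.adjoint_inner_right, norm_inner_symm]

theorem ext_hilbertBasis {V : Type*} [AddCommMonoid V] [Module 𝕜 V] [TopologicalSpace V]
    [T2Space V] (b : HilbertBasis ι 𝕜 E) {S T : E →L[𝕜] V} (h : ∀ i, S (b i) = T (b i)) : S = T :=
  ContinuousLinearMap.ext_on (Submodule.dense_iff_topologicalClosure_eq_top.2 b.dense_span)
    (Set.forall_mem_range.2 h)

end HilbertBasis

theorem summable_mul_of_summable_sq {ι : Type*} {f g : ι → ℝ}
    (hf : Summable fun i => f i ^ 2) (hg : Summable fun i => g i ^ 2) :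
    Summable fun i => f i * g i := by
  refine Summable.of_norm_bounded (hf.add hg) fun i => ?_
  rw [Real.norm_eq_abs, abs_mul, ← sq_abs (f i), ← sq_abs (g i)]
  nlinarith [two_mul_le_add_sq |f i| |g i|, sq_nonneg |f i|, sq_nonneg |g i|]

section InnerBounds

variable {𝕜 E F : Type*} [RCLike 𝕜] [NormedAddCommGroup E] [InnerProductSpace 𝕜 E]
  [NormedAddCommGroup F] [InnerProductSpace 𝕜 F]

theorem norm_inner_apply_le {T : E →L[𝕜] F} {C : ℝ} (hT : ‖T‖ ≤ C) (y : F) (x : E) :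
    ‖⟪y, T x⟫_𝕜‖ ≤ C * (‖y‖ * ‖x‖) :=
  calc ‖⟪y, T x⟫_𝕜‖ ≤ ‖y‖ * ‖T x‖ := norm_inner_le_norm _ _
    _ ≤ ‖y‖ * (C * ‖x‖) := by gcongr; exact T.le_of_opNorm_le hT x
    _ = C * (‖y‖ * ‖x‖) := by ring

theorem opNorm_le_of_norm_inner_le {T : E →L[𝕜] F} {C : ℝ} (hC : 0 ≤ C)
    (h : ∀ y x, ‖⟪y, T x⟫_𝕜‖ ≤ C * (‖y‖ * ‖x‖)) : ‖T‖ ≤ C := by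
  refine ContinuousLinearMap.opNorm_le_of_re_inner_le (𝕜 := 𝕜) hC fun x y hx hy => ?_
  calc RCLike.re ⟪T x, y⟫_𝕜 ≤ ‖⟪T x, y⟫_𝕜‖ := RCLike.re_le_norm _
    _ = ‖⟪y, T x⟫_𝕜‖ := norm_inner_symm _ _
    _ ≤ C * (‖y‖ * ‖x‖) := h y x
    _ = C := by rw [hx, hy, mul_one, mul_one]

theorem ext_inner_self_right {V : Type*} [NormedAddCommGroup V] [InnerProductSpace ℂ V]
    {S T : V →L[ℂ] V} (h : ∀ x, ⟪x, S x⟫_ℂ = ⟪x, T x⟫_ℂ) : S = T := by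
  refine ContinuousLinearMap.coe_injective ((ext_inner_map _ _).1 fun x => ?_)
  simpa only [inner_conj_symm] using! congrArg (starRingEnd ℂ) (h x)

end InnerBounds

section HilbertSchmidt

variable {ι κ : Type*}
  {H K L : Type*} [NormedAddCommGroup H] [InnerProductSpace ℂ H] [CompleteSpace H]
  [NormedAddCommGroup K] [InnerProductSpace ℂ K]
  [NormedAddCommGroup L] [InnerProductSpace ℂ L] [CompleteSpace L]

/-- A Hilbert–Schmidt operator between Hilbert spaces. Square summability is required in the basis
in which traces are computed; by `isHilbertSchmidt_iff` every Hilbert basis gives the same class. -/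
def IsHilbertSchmidt (T : H →L[ℂ] K) : Prop :=
  Summable fun i => ‖T (stdBasis H i)‖ ^ 2

theorem IsHilbertSchmidt.adjoint {T : H →L[ℂ] L} (hT : IsHilbertSchmidt T) :
    IsHilbertSchmidt (T†) :=
  (summable_sq_norm_adjoint_iff (stdBasis H) (stdBasis L)).2 hT

theorem isHilbertSchmidt_iff [CompleteSpace K] (b : HilbertBasis ι ℂ H) {T : H →L[ℂ] K} :
    IsHilbertSchmidt T ↔ Summable fun i => ‖T (b i)‖ ^ 2 :=
  (summable_sq_norm_adjoint_iff (stdBasis H) (stdBasis K)).symm.trans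
    (summable_sq_norm_adjoint_iff b (stdBasis K))

theorem IsHilbertSchmidt.comp_left {T : H →L[ℂ] K} (hT : IsHilbertSchmidt T) {V : Type*}
    [NormedAddCommGroup V] [InnerProductSpace ℂ V] (B : K →L[ℂ] V) :
    IsHilbertSchmidt (B ∘L T) := by
  refine (Summable.mul_left (‖B‖ ^ 2) hT).of_nonneg_of_le (fun _ => by positivity) fun i => ?_
  rw [← mul_pow]
  gcongr
  exact B.le_opNorm _

theorem IsHilbertSchmidt.comp_right [CompleteSpace K] {T : H →L[ℂ] K} (hT : IsHilbertSchmidt T)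
    (B : L →L[ℂ] H) : IsHilbertSchmidt (T ∘L B) := by
  simpa only [ContinuousLinearMap.adjoint_comp, ContinuousLinearMap.adjoint_adjoint] using
    (hT.adjoint.comp_left (B†)).adjoint

/-- Both traces sum the absolutely convergent double series of `⟪X† bᵢ, cⱼ⟫ ⟪cⱼ, Y bᵢ⟫`, one by rows
and the other by columns. -/
theorem hasSum_trace_comp {X : L →L[ℂ] H} {Y : H →L[ℂ] L} (hX : IsHilbertSchmidt X)
    (hY : IsHilbertSchmidt Y) (c : HilbertBasis κ ℂ L) :
    HasSum (fun j => ⟪c j, Y (X (c j))⟫_ℂ) (trace (X ∘L Y)) := by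
  set b := stdBasis H
  set f : basisIndex H × κ → ℂ := fun p => ⟪(X†) (b p.1), c p.2⟫_ℂ * ⟪c p.2, Y (b p.1)⟫_ℂ
  have hf : Summable f := by
    refine .of_norm ((summable_mul_of_summable_sq ((summable_prod_sq_norm_inner_iff c).2 hX.adjoint)
      ((summable_prod_sq_norm_inner_iff c).2 hY)).congr fun p => ?_)
    rw [norm_mul, norm_inner_symm]
  have hrow (i) : HasSum (fun j => f (i, j)) ⟪b i, X (Y (b i))⟫_ℂ := by
    rw [← ContinuousLinearMap.adjoint_inner_left]
    exact c.hasSum_inner_mul_inner ((X†) (b i)) (Y (b i))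
  have hcol (j) : HasSum (fun i => f (i, j)) ⟪c j, Y (X (c j))⟫_ℂ := by
    rw [← ContinuousLinearMap.adjoint_inner_left]
    refine (b.hasSum_inner_mul_inner ((Y†) (c j)) (X (c j))).congr_fun fun i => ?_
    simp only [f, ContinuousLinearMap.adjoint_inner_left]
    exact mul_comm _ _
  have hf_tsum : trace (X ∘L Y) = ∑' p, f p := (hf.hasSum.prod_fiberwise hrow).tsum_eq
  rw [hf_tsum, ← (Equiv.prodComm κ (basisIndex H)).tsum_eq]
  exact hf.prod_symm.hasSum.prod_fiberwise hcol

theorem hasSum_trace_comp_comp {X : L →L[ℂ] H} {Y : H →L[ℂ] L} (hX : IsHilbertSchmidt X)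
    (hY : IsHilbertSchmidt Y) (A : H →L[ℂ] H) (c : HilbertBasis κ ℂ L) :
    HasSum (fun j => ⟪(Y†) (c j), A (X (c j))⟫_ℂ) (trace ((X ∘L Y) ∘L A)) := by
  simpa only [ContinuousLinearMap.adjoint_inner_left, ContinuousLinearMap.comp_apply,
    ContinuousLinearMap.comp_assoc] using hasSum_trace_comp hX (hY.comp_right A) c

theorem hasSum_trace_comp_adjoint_comp {X : L →L[ℂ] H} (hX : IsHilbertSchmidt X)
    (A : H →L[ℂ] H) (c : HilbertBasis κ ℂ L) :
    HasSum (fun j => ⟪X (c j), A (X (c j))⟫_ℂ) (trace ((X ∘L X†) ∘L A)) := by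
  simpa only [ContinuousLinearMap.adjoint_adjoint] using
    hasSum_trace_comp_comp hX hX.adjoint A c

end HilbertSchmidt

section Factorization

/-- Douglas' lemma: the map `P x ↦ T x` is bounded on the range of `P`, hence extends to its
closure, and by `0` to the orthogonal complement. -/
theorem exists_comp_eq_of_norm_le {𝕜 E F V : Type*} [RCLike 𝕜] [NormedAddCommGroup E]
    [NormedSpace 𝕜 E] [NormedAddCommGroup F] [InnerProductSpace 𝕜 F] [CompleteSpace F]
    [NormedAddCommGroup V] [NormedSpace 𝕜 V] [CompleteSpace V] {T : E →L[𝕜] V} {P : E →L[𝕜] F}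
    {C : ℝ} (h : ∀ x, ‖T x‖ ≤ C * ‖P x‖) : ∃ W : F →L[𝕜] V, W ∘L P = T := by
  let R : Submodule 𝕜 F := P.toLinearMap.range.topologicalClosure
  have : CompleteSpace R :=
    (Submodule.isClosed_topologicalClosure P.toLinearMap.range).completeSpace_coe
  let e : E →ₗ[𝕜] R :=
    P.toLinearMap.codRestrict R fun x => Submodule.le_topologicalClosure _ ⟨x, rfl⟩
  have he : DenseRange e := by
    rw [DenseRange, Subtype.dense_iff, ← Set.range_comp]
    exact fun x hx => hx
  refine ⟨T.toLinearMap.extendOfNorm e ∘L R.orthogonalProjectionOnto, ?_⟩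
  ext x
  have hPx : R.orthogonalProjectionOnto (P x) = e x :=
    Submodule.orthogonalProjectionOnto_mem_subspace_eq_self (e x)
  rw [ContinuousLinearMap.comp_apply, ContinuousLinearMap.comp_apply, hPx,
    LinearMap.extendOfNorm_eq he ⟨C, h⟩]
  rfl

end Factorization

section TraceClass

variable {H : Type*} [NormedAddCommGroup H] [InnerProductSpace ℂ H] [CompleteSpace H]

theorem norm_abs_apply (T : H →L[ℂ] H) (x : H) : ‖CFC.abs T x‖ = ‖T x‖ := by
  have h : (CFC.abs T)† ∘L CFC.abs T = T† ∘L T := by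
    rw [← ContinuousLinearMap.star_eq_adjoint, (CFC.abs_nonneg T).isSelfAdjoint.star_eq]
    exact CFC.abs_mul_abs T
  rw [← sq_eq_sq₀ (norm_nonneg _) (norm_nonneg _),
    ContinuousLinearMap.apply_norm_sq_eq_inner_adjoint_left, h,
    ContinuousLinearMap.apply_norm_sq_eq_inner_adjoint_left]

theorem adjoint_sqrt (P : H →L[ℂ] H) : (CFC.sqrt P)† = CFC.sqrt P :=
  (CFC.sqrt_nonneg P).isSelfAdjoint.star_eq

theorem sqrt_comp_sqrt {P : H →L[ℂ] H} (hP : 0 ≤ P) : CFC.sqrt P ∘L CFC.sqrt P = P :=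
  CFC.sqrt_mul_sqrt_self P hP

theorem IsTraceClass.isHilbertSchmidt_sqrt_abs {T : H →L[ℂ] H} (hT : IsTraceClass T) :
    IsHilbertSchmidt (CFC.sqrt (CFC.abs T)) := by
  refine hT.congr fun i => ?_
  rw [ContinuousLinearMap.apply_norm_sq_eq_inner_adjoint_right, adjoint_sqrt,
    sqrt_comp_sqrt (CFC.abs_nonneg T)]
  rfl

theorem IsTraceClass.exists_eq_comp {T : H →L[ℂ] H} (hT : IsTraceClass T) :
    ∃ X Y : H →L[ℂ] H, IsHilbertSchmidt X ∧ IsHilbertSchmidt Y ∧ T = X ∘L Y := by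
  obtain ⟨W, hW⟩ := exists_comp_eq_of_norm_le (C := 1) (T := T) (P := CFC.abs T)
    fun x => by rw [one_mul, norm_abs_apply]
  refine ⟨W ∘L CFC.sqrt (CFC.abs T), CFC.sqrt (CFC.abs T),
    hT.isHilbertSchmidt_sqrt_abs.comp_left W, hT.isHilbertSchmidt_sqrt_abs, ?_⟩
  rw [ContinuousLinearMap.comp_assoc, sqrt_comp_sqrt (CFC.abs_nonneg T), hW]

theorem IsState.exists_eq_comp_adjoint {ω : H →L[ℂ] H} (hω : IsState ω) :
    ∃ X : H →L[ℂ] H, IsHilbertSchmidt X ∧ ω = X ∘L X† := by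
  have hω₀ : 0 ≤ ω := (ContinuousLinearMap.nonneg_iff_isPositive ω).2 hω.isPositive
  have hHS := hω.isTraceClass.isHilbertSchmidt_sqrt_abs
  rw [CFC.abs_of_nonneg ω hω₀] at hHS
  exact ⟨CFC.sqrt ω, hHS, by rw [adjoint_sqrt, sqrt_comp_sqrt hω₀]⟩

theorem trace_rankOne_comp (x y : H) (B : H →L[ℂ] H) :
    trace (InnerProductSpace.rankOne ℂ x y ∘L B) = ⟪y, B x⟫_ℂ := by
  rw [← ContinuousLinearMap.adjoint_inner_left, ← (stdBasis H).tsum_inner_mul_inner, trace]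
  refine tsum_congr fun i => ?_
  rw [ContinuousLinearMap.adjoint_inner_left, ContinuousLinearMap.comp_apply,
    InnerProductSpace.rankOne_apply, inner_smul_right]

theorem isState_rankOne {x : H} (hx : ‖x‖ = 1) :
    IsState (InnerProductSpace.rankOne ℂ x x) where
  isPositive := InnerProductSpace.isPositive_rankOne_self x
  isTraceClass := by
    rw [IsTraceClass, CFC.abs_of_nonneg _ ((ContinuousLinearMap.nonneg_iff_isPositive _).2
      (InnerProductSpace.isPositive_rankOne_self x))]
    refine (hasSum_sq_norm_inner (stdBasis H) x).summable.congr fun i => ?_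
    rw [InnerProductSpace.rankOne_apply, inner_smul_right, ← inner_conj_symm x, Complex.conj_mul']
    norm_cast
  trace_eq_one := by
    rw [← ContinuousLinearMap.comp_id (InnerProductSpace.rankOne ℂ x x), trace_rankOne_comp,
      ContinuousLinearMap.id_apply, inner_self_eq_norm_sq_to_K, hx]
    simp

theorem eq_of_forall_trace_eq {B C : H →L[ℂ] H}
    (h : ∀ ρ : H →L[ℂ] H, IsState ρ → trace (ρ ∘L B) = trace (ρ ∘L C)) : B = C := by
  have h_unit (u : H) (hu : ‖u‖ = 1) : ⟪u, B u⟫_ℂ = ⟪u, C u⟫_ℂ := by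
    simpa only [trace_rankOne_comp] using h _ (isState_rankOne hu)
  refine ext_inner_self_right fun x => ?_
  rcases eq_or_ne x 0 with rfl | hx
  · simp only [inner_zero_left]
  · simpa [inner_smul_left, inner_smul_right, hx] using
      h_unit _ (norm_smul_inv_norm (𝕜 := ℂ) hx)

/-- Writing a trace class operator as a product `X Y` of Hilbert–Schmidt operators turns the trace
pairing into `∑ⱼ ⟪Y† bⱼ, D X bⱼ⟫`, which converges uniformly for `D` in a bounded set. -/
theorem ultraweakTendsto_of_tendsto_inner {A : ℕ → H →L[ℂ] H} {B : H →L[ℂ] H} {C : ℝ}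
    (hA : ∀ n, ‖A n‖ ≤ C)
    (h : ∀ x y : H, Tendsto (fun n => ⟪x, A n y⟫_ℂ) atTop (𝓝 ⟪x, B y⟫_ℂ)) :
    UltraweakTendsto A B := by
  intro T hT
  obtain ⟨X, Y, hX, hY, rfl⟩ := hT.exists_eq_comp
  set b := stdBasis H
  have trace_eq (D : H →L[ℂ] H) :
      trace ((X ∘L Y) ∘L D) = ∑' j, ⟪(Y†) (b j), D (X (b j))⟫_ℂ :=
    (hasSum_trace_comp_comp hX hY D b).tsum_eq.symm
  have h_bound : Summable fun j => C * (‖(Y†) (b j)‖ * ‖X (b j)‖) :=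
    (summable_mul_of_summable_sq hY.adjoint hX).mul_left C
  simp only [trace_eq]
  exact tendsto_tsum_of_dominated_convergence h_bound (fun j => h _ _)
    (.of_forall fun n j => norm_inner_apply_le (hA n) _ _)

end TraceClass

section Tensor

variable {ι κ : Type*} {H K : Type*} [NormedAddCommGroup H] [InnerProductSpace ℂ H]
  [NormedAddCommGroup K] [InnerProductSpace ℂ K]

theorem inner_tmul (x y : H) (φ ψ : K) :
    ⟪tmul x φ, tmul y ψ⟫_ℂ = ⟪x, y⟫_ℂ * ⟪φ, ψ⟫_ℂ := by
  rw [tmul, tmul, UniformSpace.Completion.inner_coe, TensorProduct.inner_tmul]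

theorem norm_tmul (x : H) (φ : K) : ‖tmul x φ‖ = ‖x‖ * ‖φ‖ := by
  rw [tmul, UniformSpace.Completion.norm_coe, TensorProduct.norm_tmul]

variable (H K) in
/-- The map `(x, φ) ↦ x ⊗ φ` into the Hilbert space tensor product as a continuous bilinear map;
its partial applications are the operators `φ ↦ x ⊗ φ` from which partial traces are built. -/
def tmulBilin : H →L[ℂ] K →L[ℂ] HilbertTensor H K :=
  (ContinuousLinearMap.compL ℂ K (H ⊗[ℂ] K) (HilbertTensor H K)
    UniformSpace.Completion.toComplL) ∘L TensorProduct.mkL ℂ H K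

@[simp]
theorem tmulBilin_apply (x : H) (φ : K) : tmulBilin H K x φ = tmul x φ := rfl

theorem norm_tmulBilin_apply_le (x : H) : ‖tmulBilin H K x‖ ≤ ‖x‖ :=
  ContinuousLinearMap.opNorm_le_bound _ (norm_nonneg _) fun φ => (norm_tmul x φ).le

theorem ext_tmul {V : Type*} [AddCommMonoid V] [Module ℂ V] [TopologicalSpace V] [T2Space V]
    {S T : HilbertTensor H K →L[ℂ] V} (h : ∀ x φ, S (tmul x φ) = T (tmul x φ)) : S = T := by
  let ofTensor : H ⊗[ℂ] K →L[ℂ] HilbertTensor H K := UniformSpace.Completion.toComplL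
  have h_algebraic : (S ∘L ofTensor).toLinearMap = (T ∘L ofTensor).toLinearMap :=
    TensorProduct.ext' h
  exact DFunLike.coe_injective
    (UniformSpace.Completion.ext S.continuous T.continuous (LinearMap.congr_fun h_algebraic))

theorem ext_tmul_hilbertBasis (b : HilbertBasis ι ℂ H) (c : HilbertBasis κ ℂ K) {V : Type*}
    [AddCommMonoid V] [Module ℂ V] [TopologicalSpace V] [T2Space V]
    {S T : HilbertTensor H K →L[ℂ] V} (h : ∀ i j, S (tmul (b i) (c j)) = T (tmul (b i) (c j))) :
    S = T := by
  have h_left (i) : S ∘L tmulBilin H K (b i) = T ∘L tmulBilin H K (b i) :=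
    ext_hilbertBasis c (h i)
  have h_right (φ) : S ∘L (tmulBilin H K).flip φ = T ∘L (tmulBilin H K).flip φ :=
    ext_hilbertBasis b fun i => DFunLike.congr_fun (h_left i) φ
  exact ext_tmul fun x φ => DFunLike.congr_fun (h_right φ) x

theorem ext_inner_tmul {S T : HilbertTensor H K →L[ℂ] HilbertTensor H K}
    (h : ∀ x φ y ψ, ⟪tmul x φ, S (tmul y ψ)⟫_ℂ = ⟪tmul x φ, T (tmul y ψ)⟫_ℂ) : S = T := by
  refine ext_tmul fun y ψ => innerSL_inj.1 (ext_tmul fun x φ => ?_)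
  simpa only [innerSL_apply_apply, inner_conj_symm] using
    congrArg (starRingEnd ℂ) (h x φ y ψ)

@[simp]
theorem tensorOp_tmul (S : H →L[ℂ] H) (T : K →L[ℂ] K) (x : H) (φ : K) :
    tensorOp S T (tmul x φ) = tmul (S x) (T φ) := by
  rw [tensorOp, tmul, ContinuousLinearMap.completion_apply_coe, TensorProduct.mapL_tmul, tmul]

theorem tensorOp_comp (S S' : H →L[ℂ] H) (T T' : K →L[ℂ] K) :
    tensorOp (S ∘L S') (T ∘L T') = tensorOp S T ∘L tensorOp S' T' :=
  ext_tmul fun x φ => by simp only [tensorOp_tmul, ContinuousLinearMap.comp_apply]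

theorem tensorOp_one : tensorOp (1 : H →L[ℂ] H) (1 : K →L[ℂ] K) = 1 :=
  ext_tmul fun x φ => by simp only [tensorOp_tmul, one_apply_eq_self]

theorem tensorOp_sum_left (s : Finset ι) (S : ι → H →L[ℂ] H) (T : K →L[ℂ] K) :
    tensorOp (∑ i ∈ s, S i) T = ∑ i ∈ s, tensorOp (S i) T :=
  ext_tmul fun x φ => by
    simp only [tensorOp_tmul, sum_apply]
    simp only [← tmulBilin_apply, map_sum, sum_apply]

theorem norm_tensorOp_le (S : H →L[ℂ] H) (T : K →L[ℂ] K) : ‖tensorOp S T‖ ≤ ‖S‖ * ‖T‖ := by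
  refine ContinuousLinearMap.opNorm_le_bound _ (by positivity) fun u => ?_
  induction u using UniformSpace.Completion.induction_on with
  | hp => exact isClosed_le (by fun_prop) (by fun_prop)
  | ih t =>
    rw [tensorOp, ContinuousLinearMap.completion_apply_coe, UniformSpace.Completion.norm_coe,
      UniformSpace.Completion.norm_coe]
    exact ContinuousLinearMap.le_of_opNorm_le _ (TensorProduct.norm_mapL_le S T) t

theorem adjoint_tensorOp [CompleteSpace H] [CompleteSpace K] (S : H →L[ℂ] H) (T : K →L[ℂ] K) :
    (tensorOp S T)† = tensorOp (S†) (T†) :=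
  ext_inner_tmul fun x φ y ψ => by
    simp only [ContinuousLinearMap.adjoint_inner_right, tensorOp_tmul, inner_tmul]

theorem orthonormal_tmul {v : ι → H} {w : κ → K} (hv : Orthonormal ℂ v) (hw : Orthonormal ℂ w) :
    Orthonormal ℂ fun p : ι × κ => tmul (v p.1) (w p.2) :=
  (hv.tmul hw).comp_linearIsometry UniformSpace.Completion.toComplₗᵢ

/-- The Hilbert basis `bᵢ ⊗ cⱼ` of the Hilbert space tensor product. -/
def tensorBasis (b : HilbertBasis ι ℂ H) (c : HilbertBasis κ ℂ K) :
    HilbertBasis (ι × κ) ℂ (HilbertTensor H K) :=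
  .mkOfOrthogonalEqBot (orthonormal_tmul b.orthonormal c.orthonormal) <| by
    refine (Submodule.eq_bot_iff _).2 fun v hv => ?_
    have h_inner : innerSL ℂ v = 0 := ext_tmul_hilbertBasis b c fun i j =>
      (Submodule.mem_orthogonal' _ _).1 hv _ (Submodule.subset_span ⟨(i, j), rfl⟩)
    exact inner_self_eq_zero.1 (DFunLike.congr_fun h_inner v)

@[simp]
theorem tensorBasis_apply (b : HilbertBasis ι ℂ H) (c : HilbertBasis κ ℂ K) (p : ι × κ) :
    tensorBasis b c p = tmul (b p.1) (c p.2) := by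
  rw [tensorBasis, HilbertBasis.coe_mkOfOrthogonalEqBot]

theorem IsHilbertSchmidt.tensorOp [CompleteSpace H] [CompleteSpace K] {S : H →L[ℂ] H}
    {T : K →L[ℂ] K} (hS : IsHilbertSchmidt S) (hT : IsHilbertSchmidt T) :
    IsHilbertSchmidt (tensorOp S T) := by
  refine (isHilbertSchmidt_iff (tensorBasis (stdBasis H) (stdBasis K))).2 ?_
  refine (Summable.mul_of_nonneg hS hT (fun _ => sq_nonneg _) fun _ => sq_nonneg _).congr
    fun p => ?_
  rw [tensorBasis_apply, tensorOp_tmul, norm_tmul, mul_pow]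

end Tensor

section Restriction

variable {κ : Type*} {H K : Type*} [NormedAddCommGroup H] [InnerProductSpace ℂ H]
  [NormedAddCommGroup K] [InnerProductSpace ℂ K] [CompleteSpace K]

/-- The partial expectation `∑ₖ (xₖ ⊗ ·)† T (xₖ ⊗ ·)` of `T` in the vectors `xₖ`: the partial
trace of `(∑ₖ |xₖ⟩⟨xₖ| ⊗ 1) T` over the first factor. The series converges in norm when
`∑ₖ ‖xₖ‖² < ∞`; if it is not summable, its junk value is `0`. -/
def partialExpectation (x : κ → H) (T : HilbertTensor H K →L[ℂ] HilbertTensor H K) : K →L[ℂ] K :=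
  ∑' k, (tmulBilin H K (x k))† ∘L T ∘L tmulBilin H K (x k)

theorem hasSum_inner_partialExpectation {x : κ → H} (hx : Summable fun k => ‖x k‖ ^ 2)
    (T : HilbertTensor H K →L[ℂ] HilbertTensor H K) (φ ψ : K) :
    HasSum (fun k => ⟪tmul (x k) φ, T (tmul (x k) ψ)⟫_ℂ) ⟪φ, partialExpectation x T ψ⟫_ℂ := by
  have h_summable : Summable fun k => (tmulBilin H K (x k))† ∘L T ∘L tmulBilin H K (x k) := by
    refine Summable.of_norm_bounded (hx.mul_left ‖T‖) fun k => ?_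
    calc ‖(tmulBilin H K (x k))† ∘L T ∘L tmulBilin H K (x k)‖
        ≤ ‖tmulBilin H K (x k)‖ * (‖T‖ * ‖tmulBilin H K (x k)‖) := by
          rw [← LinearIsometryEquiv.norm_map ContinuousLinearMap.adjoint (tmulBilin H K (x k))]
          exact (ContinuousLinearMap.opNorm_comp_le _ _).trans
            (by rw [LinearIsometryEquiv.norm_map]; gcongr; exact T.opNorm_comp_le _)
      _ ≤ ‖x k‖ * (‖T‖ * ‖x k‖) := by gcongr <;> exact norm_tmulBilin_apply_le _
      _ = ‖T‖ * ‖x k‖ ^ 2 := by ring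
  refine ((innerSL ℂ φ).hasSum
    ((ContinuousLinearMap.apply ℂ K ψ).hasSum h_summable.hasSum)).congr_fun fun k => ?_
  rw [ContinuousLinearMap.apply_apply, innerSL_apply_apply, ContinuousLinearMap.comp_apply,
    ContinuousLinearMap.adjoint_inner_right]
  rfl

theorem IsRestriction.unique {ω : H →L[ℂ] H} {T : HilbertTensor H K →L[ℂ] HilbertTensor H K}
    {B C : K →L[ℂ] K} (hB : IsRestriction ω T B) (hC : IsRestriction ω T C) : B = C :=
  eq_of_forall_trace_eq fun ρ hρ => (hB ρ hρ).trans (hC ρ hρ).symm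

variable [CompleteSpace H]

theorem isRestriction_partialExpectation {X : H →L[ℂ] H} (hX : IsHilbertSchmidt X)
    (T : HilbertTensor H K →L[ℂ] HilbertTensor H K) :
    IsRestriction (X ∘L X†) T (partialExpectation (fun k => X (stdBasis H k)) T) := by
  intro ρ hρ
  obtain ⟨Z, hZ, rfl⟩ := hρ.exists_eq_comp_adjoint
  have h_left := hasSum_trace_comp_adjoint_comp hZ
    (partialExpectation (fun k => X (stdBasis H k)) T) (stdBasis K)
  have h_right := hasSum_trace_comp_adjoint_comp (hX.tensorOp hZ) T
    (tensorBasis (stdBasis H) (stdBasis K))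
  rw [adjoint_tensorOp, ← tensorOp_comp] at h_right
  simp only [tensorBasis_apply, tensorOp_tmul] at h_right
  rw [← (Equiv.prodComm (basisIndex K) (basisIndex H)).hasSum_iff] at h_right
  exact h_left.unique <| h_right.prod_fiberwise fun j =>
    hasSum_inner_partialExpectation hX T (Z (stdBasis K j)) (Z (stdBasis K j))

theorem restriction_comp_adjoint {X : H →L[ℂ] H} (hX : IsHilbertSchmidt X)
    (T : HilbertTensor H K →L[ℂ] HilbertTensor H K) :
    restriction (X ∘L X†) T = partialExpectation (fun k => X (stdBasis H k)) T := by
  have h_exists : ∃ B : K →L[ℂ] K, IsRestriction (X ∘L X†) T B :=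
    ⟨_, isRestriction_partialExpectation hX T⟩
  rw [restriction, dif_pos h_exists]
  exact h_exists.choose_spec.unique (isRestriction_partialExpectation hX T)

theorem existsUnique_isRestriction {ω : H →L[ℂ] H} (hω : IsState ω)
    (T : HilbertTensor H K →L[ℂ] HilbertTensor H K) :
    ∃! B : K →L[ℂ] K, IsRestriction ω T B := by
  obtain ⟨X, hX, rfl⟩ := hω.exists_eq_comp_adjoint
  exact ⟨_, isRestriction_partialExpectation hX T,
    fun B hB => hB.unique (isRestriction_partialExpectation hX T)⟩

end Restriction

section WeakLimit

variable {𝕜 ι : Type*} [RCLike 𝕜] {F : Type*} [NormedAddCommGroup F] [InnerProductSpace 𝕜 F]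
  [CompleteSpace F]

theorem exists_tendsto_inner_of_norm_le (l : Ultrafilter ι) {y : ι → F} {C : ℝ}
    (hy : ∀ i, ‖y i‖ ≤ C) :
    ∃ z : F, ‖z‖ ≤ C ∧ ∀ u, Tendsto (fun i => ⟪u, y i⟫_𝕜) l (𝓝 ⟪u, z⟫_𝕜) := by
  let toWeak : F → WeakDual 𝕜 F := fun x => StrongDual.toWeakDual (InnerProductSpace.toDual 𝕜 F x)
  have h_mem (i) : toWeak (y i) ∈ WeakDual.toStrongDual ⁻¹' Metric.closedBall 0 C := by
    rw [Set.mem_preimage, mem_closedBall_zero_iff]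
    exact ((InnerProductSpace.toDual 𝕜 F).norm_map (y i)).trans_le (hy i)
  have h_compact := WeakDual.isCompact_closedBall (0 : StrongDual 𝕜 F) C
  obtain ⟨f, hf, hlim⟩ := h_compact.ultrafilter_le_nhds
    (l.map fun i => toWeak (y i)) (le_principal_iff.2 (Filter.mem_map.2 (univ_mem' h_mem)))
  refine ⟨(InnerProductSpace.toDual 𝕜 F).symm (WeakDual.toStrongDual f), ?_, fun u => ?_⟩
  · rw [LinearIsometryEquiv.norm_map]
    exact mem_closedBall_zero_iff.1 hf
  · have h_eval : Tendsto (fun i => ⟪y i, u⟫_𝕜) l (𝓝 (f u)) :=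
      ((WeakDual.eval_continuous u).tendsto f).comp hlim
    rw [← inner_conj_symm, InnerProductSpace.toDual_symm_apply]
    simpa only [Function.comp_def, inner_conj_symm] using!
      (RCLike.continuous_conj.tendsto _).comp h_eval

theorem exists_tendsto_inner_apply_of_opNorm_le {E : Type*} [NormedAddCommGroup E]
    [NormedSpace 𝕜 E] (l : Ultrafilter ι) {T : ι → E →L[𝕜] F} {C : ℝ} (hT : ∀ i, ‖T i‖ ≤ C) :
    ∃ Z : E →L[𝕜] F, ‖Z‖ ≤ C ∧ ∀ y x, Tendsto (fun i => ⟪y, T i x⟫_𝕜) l (𝓝 ⟪y, Z x⟫_𝕜) := by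
  obtain ⟨i₀, -⟩ := l.nonempty_of_mem univ_mem
  have hC : 0 ≤ C := (norm_nonneg _).trans (hT i₀)
  choose z hz hlim using fun x => exists_tendsto_inner_of_norm_le (𝕜 := 𝕜) l
    fun i => (T i).le_of_opNorm_le (hT i) x
  let Z : E →ₗ[𝕜] F :=
    { toFun := z
      map_add' := fun x x' => ext_inner_left 𝕜 fun y => by
        refine tendsto_nhds_unique (hlim (x + x') y) ?_
        simpa only [map_add, inner_add_right] using (hlim x y).add (hlim x' y)
      map_smul' := fun c x => ext_inner_left 𝕜 fun y => by
        refine tendsto_nhds_unique (hlim (c • x) y) ?_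
        simpa only [map_smul, inner_smul_right, RingHom.id_apply] using (hlim x y).const_mul c }
  exact ⟨Z.mkContinuous C hz, Z.mkContinuous_norm_le hC hz, fun y x => hlim x y⟩

end WeakLimit

section NormBound

variable {ι : Type*}

section Resolution

variable {𝕜 E F : Type*} [RCLike 𝕜] [NormedAddCommGroup E] [InnerProductSpace 𝕜 E]
  [CompleteSpace E] [NormedAddCommGroup F] [InnerProductSpace 𝕜 F] [CompleteSpace F]
  {s : Finset ι} {R : ι → E →L[𝕜] F}

theorem sum_sq_norm_of_sum_adjoint_comp_eq_one (hR : ∑ i ∈ s, (R i)† ∘L R i = 1) (x : E) :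
    ∑ i ∈ s, ‖R i x‖ ^ 2 = ‖x‖ ^ 2 := by
  simp only [ContinuousLinearMap.apply_norm_sq_eq_inner_adjoint_right]
  rw [← map_sum, ← inner_sum, ← sum_apply, hR, one_apply_eq_self, inner_self_eq_norm_sq]

theorem norm_sum_adjoint_comp_comp_le (hR : ∑ i ∈ s, (R i)† ∘L R i = 1) {B : ι → F →L[𝕜] F}
    {C : ℝ} (hC : 0 ≤ C) (hB : ∀ i ∈ s, ‖B i‖ ≤ C) :
    ‖∑ i ∈ s, (R i)† ∘L B i ∘L R i‖ ≤ C := by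
  refine opNorm_le_of_norm_inner_le hC fun y x => ?_
  calc ‖⟪y, (∑ i ∈ s, (R i)† ∘L B i ∘L R i) x⟫_𝕜‖
      = ‖∑ i ∈ s, ⟪R i y, B i (R i x)⟫_𝕜‖ := by
        simp only [sum_apply, inner_sum, ContinuousLinearMap.comp_apply,
          ContinuousLinearMap.adjoint_inner_right]
    _ ≤ ∑ i ∈ s, C * (‖R i y‖ * ‖R i x‖) :=
        norm_sum_le_of_le _ fun i hi => norm_inner_apply_le (hB i hi) _ _
    _ = C * ∑ i ∈ s, ‖R i y‖ * ‖R i x‖ := (Finset.mul_sum _ _ _).symm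
    _ ≤ C * (√(∑ i ∈ s, ‖R i y‖ ^ 2) * √(∑ i ∈ s, ‖R i x‖ ^ 2)) := by
        gcongr
        exact Real.sum_mul_le_sqrt_mul_sqrt _ _ _
    _ = C * (‖y‖ * ‖x‖) := by
        simp only [sum_sq_norm_of_sum_adjoint_comp_eq_one hR, Real.sqrt_sq (norm_nonneg _)]

end Resolution

/-- Since `Pᵢ ⊗ Aᵢ = (√Pᵢ ⊗ 1)† (1 ⊗ Aᵢ) (√Pᵢ ⊗ 1)`, the sum is a compression of a block diagonal
operator by an isometry. -/
theorem norm_sum_tensorOp_le {H K : Type*} [NormedAddCommGroup H] [InnerProductSpace ℂ H]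
    [CompleteSpace H] [NormedAddCommGroup K] [InnerProductSpace ℂ K] [CompleteSpace K]
    {s : Finset ι} {P : ι → H →L[ℂ] H} (hP : ∀ i ∈ s, (P i).IsPositive)
    (hP_sum : ∑ i ∈ s, P i = 1) {A : ι → K →L[ℂ] K} {C : ℝ} (hC : 0 ≤ C)
    (hA : ∀ i ∈ s, ‖A i‖ ≤ C) : ‖∑ i ∈ s, tensorOp (P i) (A i)‖ ≤ C := by
  let R (i : ι) : HilbertTensor H K →L[ℂ] HilbertTensor H K := tensorOp (CFC.sqrt (P i)) 1
  have hR_adjoint (i) : (R i)† = R i := by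
    rw [adjoint_tensorOp, adjoint_sqrt, ← ContinuousLinearMap.star_eq_adjoint 1, star_one]
  have h_factor (i) (hi : i ∈ s) (B : K →L[ℂ] K) :
      tensorOp (P i) B = (R i)† ∘L tensorOp 1 B ∘L R i := by
    rw [hR_adjoint, ← tensorOp_comp, ← tensorOp_comp]
    exact congrArg (fun Q => tensorOp Q B)
      (sqrt_comp_sqrt ((ContinuousLinearMap.nonneg_iff_isPositive _).2 (hP i hi))).symm
  have hR : ∑ i ∈ s, (R i)† ∘L R i = 1 := by
    rw [← tensorOp_one, ← hP_sum, tensorOp_sum_left]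
    refine Finset.sum_congr rfl fun i hi => ?_
    rw [h_factor i hi, tensorOp_one]
    rfl
  have h_norm (i) (hi : i ∈ s) : ‖tensorOp (1 : H →L[ℂ] H) (A i)‖ ≤ C :=
    (norm_tensorOp_le _ _).trans <|
      (mul_le_of_le_one_left (norm_nonneg _) ContinuousLinearMap.norm_id_le).trans (hA i hi)
  rw [Finset.sum_congr rfl fun i hi => h_factor i hi (A i)]
  exact norm_sum_adjoint_comp_comp_le hR hC h_norm

end NormBound

section POVM

variable {Ω : Type*} [MeasurableSpace Ω]

theorem exists_simpleFunc_tendsto_comp {V : Type*} [PseudoEMetricSpace V] [MeasurableSpace V]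
    [OpensMeasurableSpace V] [SecondCountableTopology V] {Φ : Ω → V} (hΦ : Measurable Φ) :
    ∃ σ : ℕ → SimpleFunc Ω Ω, ∀ a, Tendsto (fun n => Φ (σ n a)) atTop (𝓝 (Φ a)) := by
  rcases isEmpty_or_nonempty Ω with _ | ⟨⟨a₀⟩⟩
  · exact ⟨fun _ => SimpleFunc.ofIsEmpty, isEmptyElim⟩
  have h₀ : Φ a₀ ∈ Set.range Φ := ⟨a₀, rfl⟩
  let f := SimpleFunc.approxOn Φ hΦ (Set.range Φ) (Φ a₀) h₀
  have hf_mem (n a) : f n a ∈ Set.range Φ := SimpleFunc.approxOn_mem hΦ h₀ n a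
  have : Nonempty Ω := ⟨a₀⟩
  refine ⟨fun n => (f n).map (Function.invFun Φ), fun a => ?_⟩
  simp only [SimpleFunc.map_apply, Function.invFun_eq (hf_mem _ a)]
  exact SimpleFunc.tendsto_approxOn hΦ h₀ (subset_closure ⟨a, rfl⟩)

variable {H K : Type*} [NormedAddCommGroup H] [InnerProductSpace ℂ H] [CompleteSpace H]
  [NormedAddCommGroup K] [InnerProductSpace ℂ K] (E : POVM Ω H)

theorem POVM.inner_effect_self {X : Set Ω} (hX : MeasurableSet X) (x : H) :
    ⟪x, E.effect X x⟫_ℂ = ((E.vectorMeasure x).real X : ℂ) := by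
  obtain ⟨h_re, h_im⟩ := Complex.nonneg_iff.1 ((E.isPositive X hX).inner_nonneg_right x)
  rw [Measure.real, E.vectorMeasure_apply x hX, ENNReal.toReal_ofReal h_re]
  exact Complex.ext rfl h_im.symm

instance POVM.isFiniteMeasure_vectorMeasure (x : H) : IsFiniteMeasure (E.vectorMeasure x) :=
  ⟨by rw [E.vectorMeasure_apply x MeasurableSet.univ]; exact ENNReal.ofReal_lt_top⟩

theorem POVM.sum_effect_fiber {ι : Type*} (f : SimpleFunc Ω ι) :
    ∑ i ∈ f.range, E.effect (f ⁻¹' {i}) = 1 := by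
  refine ext_inner_self_right fun x => ?_
  rw [sum_apply, inner_sum, ← E.effect_univ, E.inner_effect_self MeasurableSet.univ]
  simp only [E.inner_effect_self (f.measurableSet_fiber _)]
  rw [← Complex.ofReal_sum, sum_measureReal_preimage_singleton _
    (fun i _ => f.measurableSet_fiber i), SimpleFunc.coe_range, Set.preimage_range]

/-- The operator integral `∫ dE(a) ⊗ f(a)` of an operator-valued simple function. -/
def POVM.simpleIntegral (f : SimpleFunc Ω (K →L[ℂ] K)) :
    HilbertTensor H K →L[ℂ] HilbertTensor H K :=
  ∑ A ∈ f.range, tensorOp (E.effect (f ⁻¹' {A})) A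

theorem POVM.norm_simpleIntegral_le [CompleteSpace K] {f : SimpleFunc Ω (K →L[ℂ] K)} {C : ℝ}
    (hC : 0 ≤ C) (hf : ∀ a, ‖f a‖ ≤ C) : ‖E.simpleIntegral f‖ ≤ C :=
  norm_sum_tensorOp_le (fun _ _ => E.isPositive _ (f.measurableSet_fiber _))
    (E.sum_effect_fiber f) hC (SimpleFunc.forall_mem_range.2 hf)

theorem POVM.inner_simpleIntegral (f : SimpleFunc Ω (K →L[ℂ] K)) (x : H) (φ ψ : K) :
    ⟪tmul x φ, E.simpleIntegral f (tmul x ψ)⟫_ℂ = ∫ a, ⟪φ, f a ψ⟫_ℂ ∂E.vectorMeasure x := by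
  let g : (K →L[ℂ] K) → ℂ := fun A => ⟪φ, A ψ⟫_ℂ
  calc ⟪tmul x φ, E.simpleIntegral f (tmul x ψ)⟫_ℂ
      = ∑ A ∈ f.range, (E.vectorMeasure x).real (f ⁻¹' {A}) • g A := by
        simp only [POVM.simpleIntegral, sum_apply, inner_sum, tensorOp_tmul, inner_tmul,
          E.inner_effect_self (f.measurableSet_fiber _), Complex.real_smul, g]
    _ = (f.map g).integral (E.vectorMeasure x) :=
        (SimpleFunc.map_integral f g (f.integrable_of_isFiniteMeasure) (by simp [g])).symm
    _ = ∫ a, ⟪φ, f a ψ⟫_ℂ ∂E.vectorMeasure x :=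
        SimpleFunc.integral_eq_integral _ (f.map g).integrable_of_isFiniteMeasure

/-- `Y` is the operator `∫ dE(a) ⊗ F(a)`, the integral being understood weakly. Testing on equal
left vectors determines `Y` by polarization. The relativization is the case `F g = g.A`. -/
def POVM.IsWeakIntegral (F : Ω → K →L[ℂ] K) (Y : HilbertTensor H K →L[ℂ] HilbertTensor H K) :
    Prop :=
  ∀ (x : H) (φ ψ : K), ⟪tmul x φ, Y (tmul x ψ)⟫_ℂ = ∫ a, ⟪φ, F a ψ⟫_ℂ ∂E.vectorMeasure x

variable {E} {F : Ω → K →L[ℂ] K}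

theorem POVM.IsWeakIntegral.unique {Y Z : HilbertTensor H K →L[ℂ] HilbertTensor H K}
    (hY : E.IsWeakIntegral F Y) (hZ : E.IsWeakIntegral F Z) : Y = Z := by
  refine ext_inner_tmul fun x φ y ψ => ?_
  let rightMul (χ : K) : H →L[ℂ] HilbertTensor H K := (tmulBilin H K).flip χ
  let slice (W : HilbertTensor H K →L[ℂ] HilbertTensor H K) : H →L[ℂ] H :=
    (rightMul φ)† ∘L W ∘L rightMul ψ
  have inner_slice (W x y) : ⟪x, slice W y⟫_ℂ = ⟪tmul x φ, W (tmul y ψ)⟫_ℂ :=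
    ContinuousLinearMap.adjoint_inner_right (rightMul φ) _ _
  have h_slice : slice Y = slice Z := ext_inner_self_right fun x => by
    rw [inner_slice, inner_slice, hY, hZ]
  rw [← inner_slice, h_slice, inner_slice]

variable [CompleteSpace K]

theorem POVM.exists_weakIntegral_on_finset (E : POVM Ω H) {C : ℝ} (hC : 0 ≤ C)
    (hF_le : ∀ a, ‖F a‖ ≤ C) (hF : ∀ φ ψ, Measurable fun a => ⟪φ, F a ψ⟫_ℂ)
    (s : Finset (K × K)) :
    ∃ Y : HilbertTensor H K →L[ℂ] HilbertTensor H K, ‖Y‖ ≤ C ∧ ∀ p ∈ s, ∀ x,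
      ⟪tmul x p.1, Y (tmul x p.2)⟫_ℂ = ∫ a, ⟪p.1, F a p.2⟫_ℂ ∂E.vectorMeasure x := by
  let Φ : Ω → s → ℂ := fun a p => ⟪p.1.1, F a p.1.2⟫_ℂ
  obtain ⟨σ, hσ⟩ := exists_simpleFunc_tendsto_comp (Φ := Φ)
    (measurable_pi_lambda _ fun p => hF _ _)
  obtain ⟨Y, hY, hlim⟩ := exists_tendsto_inner_apply_of_opNorm_le (𝕜 := ℂ) (hyperfilter ℕ)
    fun n => E.norm_simpleIntegral_le (f := (σ n).map F) hC fun a => hF_le (σ n a)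
  refine ⟨Y, hY, fun p hp x => tendsto_nhds_unique (hlim _ _) ?_⟩
  simp only [E.inner_simpleIntegral, SimpleFunc.map_apply]
  refine Tendsto.mono_left ?_ Nat.hyperfilter_le_atTop
  refine tendsto_integral_of_dominated_convergence (fun _ => C * (‖p.1‖ * ‖p.2‖)) (fun n => ?_)
    (integrable_const _) (fun n => .of_forall fun a => norm_inner_apply_le (hF_le _) _ _)
    (.of_forall fun a => (tendsto_pi_nhds.1 (hσ a)) ⟨p, hp⟩)
  exact ((σ n).map fun a => ⟪p.1, F a p.2⟫_ℂ).aestronglyMeasurable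

/-- Simple functions approximate finitely many matrix elements of `F` at a time, so a second weak
limit, along the finite sets of matrix elements, is needed. -/
theorem POVM.exists_isWeakIntegral (E : POVM Ω H) {C : ℝ} (hC : 0 ≤ C) (hF_le : ∀ a, ‖F a‖ ≤ C)
    (hF : ∀ φ ψ, Measurable fun a => ⟪φ, F a ψ⟫_ℂ) :
    ∃ Y : HilbertTensor H K →L[ℂ] HilbertTensor H K, E.IsWeakIntegral F Y := by
  choose Y hY hY_inner using E.exists_weakIntegral_on_finset hC hF_le hF
  let l : Ultrafilter (Finset (K × K)) := .of atTop
  obtain ⟨Z, -, hlim⟩ := exists_tendsto_inner_apply_of_opNorm_le (𝕜 := ℂ) l hY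
  refine ⟨Z, fun x φ ψ => tendsto_nhds_unique (hlim _ _) (tendsto_const_nhds.congr' ?_)⟩
  filter_upwards [Ultrafilter.of_le _ (eventually_ge_atTop {(φ, ψ)})] with s hs
  exact (hY_inner s (φ, ψ) (Finset.singleton_subset_iff.1 hs) x).symm

theorem POVM.IsBornMeasure.eq_sum {X : H →L[ℂ] H} (hX : IsHilbertSchmidt X)
    {μ : ProbabilityMeasure Ω} (hμ : E.IsBornMeasure (X ∘L X†) μ) :
    (μ : Measure Ω) = Measure.sum fun k => E.vectorMeasure (X (stdBasis H k)) := by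
  ext S hS
  have h := hasSum_trace_comp_adjoint_comp hX (E.effect S) (stdBasis H)
  rw [← hμ S hS] at h
  simp only [E.inner_effect_self hS] at h
  have h_real := Complex.hasSum_ofReal.1 h
  rw [Measure.sum_apply _ hS, ← ofReal_measureReal, ← h_real.tsum_eq,
    ENNReal.ofReal_tsum_of_nonneg (fun _ => measureReal_nonneg) h_real.summable]
  exact tsum_congr fun _ => ofReal_measureReal

theorem POVM.IsWeakIntegral.inner_restriction {Y : HilbertTensor H K →L[ℂ] HilbertTensor H K}
    (hY : E.IsWeakIntegral F Y) {ω : H →L[ℂ] H} (hω : IsState ω) {μ : ProbabilityMeasure Ω}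
    (hμ : E.IsBornMeasure ω μ) {φ ψ : K}
    (hF : Integrable (fun a => ⟪φ, F a ψ⟫_ℂ) (μ : Measure Ω)) :
    ⟪φ, restriction ω Y ψ⟫_ℂ = ∫ a, ⟪φ, F a ψ⟫_ℂ ∂(μ : Measure Ω) := by
  obtain ⟨X, hX, rfl⟩ := hω.exists_eq_comp_adjoint
  rw [hμ.eq_sum hX] at hF ⊢
  rw [restriction_comp_adjoint hX]
  refine (hasSum_inner_partialExpectation hX Y φ ψ).unique ?_
  simpa only [hY _ φ ψ] using hasSum_integral_measure hF

theorem POVM.IsWeakIntegral.ultraweakTendsto_restriction [TopologicalSpace Ω]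
    [OpensMeasurableSpace Ω] {Y : HilbertTensor H K →L[ℂ] HilbertTensor H K}
    (hY : E.IsWeakIntegral F Y) {C : ℝ} (hF_le : ∀ a, ‖F a‖ ≤ C)
    (hF : ∀ φ ψ, Continuous fun a => ⟪φ, F a ψ⟫_ℂ) {a : Ω} {ω : ℕ → H →L[ℂ] H}
    (hω : E.IsLocalizingSequence a ω) :
    UltraweakTendsto (fun n => restriction (ω n) Y) (F a) := by
  obtain ⟨h_state, μ, hμ, hμ_lim⟩ := hω
  let matrixElement (φ ψ : K) : BoundedContinuousFunction Ω ℂ :=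
    .ofNormedAddCommGroup (fun a => ⟪φ, F a ψ⟫_ℂ) (hF φ ψ) (C * (‖φ‖ * ‖ψ‖))
      fun a => norm_inner_apply_le (hF_le a) φ ψ
  have h_inner (n φ ψ) :
      ⟪φ, restriction (ω n) Y ψ⟫_ℂ = ∫ b, matrixElement φ ψ b ∂(μ n : Measure Ω) :=
    hY.inner_restriction (h_state n) (hμ n) ((matrixElement φ ψ).integrable _)
  refine ultraweakTendsto_of_tendsto_inner (C := C) (fun n => ?_) fun φ ψ => ?_
  · refine opNorm_le_of_norm_inner_le ((norm_nonneg _).trans (hF_le a)) fun φ ψ => ?_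
    rw [h_inner]
    refine (norm_integral_le_of_norm_le_const
      (.of_forall fun b => norm_inner_apply_le (hF_le b) φ ψ)).trans_eq ?_
    rw [probReal_univ, mul_one]
  · have h_dirac : ∫ b, matrixElement φ ψ b ∂(diracProba a : Measure Ω) = ⟪φ, F a ψ⟫_ℂ :=
      integral_dirac' _ _ (matrixElement φ ψ).continuous.stronglyMeasurable
    simp only [h_inner, ← h_dirac]
    exact (ProbabilityMeasure.tendsto_iff_forall_integral_rclike_tendsto ℂ).1 hμ_lim _

end POVM

section Representation

variable {G : Type*} [Group G] [TopologicalSpace G]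
  {K : Type*} [NormedAddCommGroup K] [InnerProductSpace ℂ K] [CompleteSpace K]

theorem UnitaryRep.norm_act (U : UnitaryRep G K) (g : G) (A : K →L[ℂ] K) :
    ‖U.act g A‖ = ‖A‖ :=
  (CStarRing.norm_coe_unitary_mul (U.toHom g) _).trans
    (CStarRing.norm_mul_coe_unitary A (star (U.toHom g)))

theorem UnitaryRep.act_one (U : UnitaryRep G K) (A : K →L[ℂ] K) : U.act 1 A = A := by
  rw [UnitaryRep.act, map_one, OneMemClass.coe_one, ← ContinuousLinearMap.star_eq_adjoint,
    star_one]
  rfl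

theorem UnitaryRep.adjoint_toHom (U : UnitaryRep G K) (g : G) :
    (U.toHom g : K →L[ℂ] K)† = U.toHom g⁻¹ := by
  rw [map_inv]
  rfl

theorem UnitaryRep.continuous_inner_act [ContinuousInv G] (U : UnitaryRep G K)
    (A : K →L[ℂ] K) (φ ψ : K) : Continuous fun g => ⟪φ, U.act g A ψ⟫_ℂ := by
  have h_inner (g) : ⟪φ, U.act g A ψ⟫_ℂ =
      ⟪(U.toHom g⁻¹ : K →L[ℂ] K) φ, A ((U.toHom g⁻¹ : K →L[ℂ] K) ψ)⟫_ℂ := by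
    rw [← U.adjoint_toHom, ContinuousLinearMap.adjoint_inner_left]
    rfl
  simp only [h_inner]
  exact ((U.strongly_continuous φ).comp continuous_inv).inner
    (A.continuous.comp ((U.strongly_continuous ψ).comp continuous_inv))

theorem isRelativization_relativization [IsTopologicalGroup G] [MeasurableSpace G] [BorelSpace G]
    {H : Type*} [NormedAddCommGroup H] [InnerProductSpace ℂ H] [CompleteSpace H]
    {R : PrincipalFrame G H} {U : UnitaryRep G K} {A : K →L[ℂ] K}
    (h : ∃ Y, IsRelativization R U A Y) : IsRelativization R U A (relativization R U A) := by
  rw [relativization, dif_pos h]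
  exact h.choose_spec

end Representation

end

end QRF

theorem theorem3p1_general {Ω : Type*} [TopologicalSpace Ω] [MeasurableSpace Ω]
    [OpensMeasurableSpace Ω]
    {H : Type*} [NormedAddCommGroup H] [InnerProductSpace ℂ H] [CompleteSpace H]
    {K : Type*} [NormedAddCommGroup K] [InnerProductSpace ℂ K] [CompleteSpace K]
    {E : QRF.POVM Ω H} {a : Ω} {ω : ℕ → H →L[ℂ] H} (hω : E.IsLocalizingSequence a ω)
    {F : Ω → K →L[ℂ] K} {C : ℝ} (hF_le : ∀ b, ‖F b‖ ≤ C)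
    (hF : ∀ φ ψ, Continuous fun b => ⟪φ, F b ψ⟫_ℂ) :
    (∃! Y : QRF.HilbertTensor H K →L[ℂ] QRF.HilbertTensor H K, E.IsWeakIntegral F Y) ∧
    (∀ (n : ℕ) (T : QRF.HilbertTensor H K →L[ℂ] QRF.HilbertTensor H K),
      ∃! B : K →L[ℂ] K, QRF.IsRestriction (ω n) T B) ∧
    ∀ Y : QRF.HilbertTensor H K →L[ℂ] QRF.HilbertTensor H K, E.IsWeakIntegral F Y →
      QRF.UltraweakTendsto (fun n => QRF.restriction (ω n) Y) (F a) := by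
  refine ⟨existsUnique_of_exists_of_unique ?_ fun Y Z hY hZ => hY.unique hZ,
    fun n T => QRF.existsUnique_isRestriction (hω.1 n) T,
    fun Y hY => hY.ultraweakTendsto_restriction hF_le hF hω⟩
  exact E.exists_isWeakIntegral ((norm_nonneg _).trans (hF_le a)) hF_le
    fun φ ψ => (hF φ ψ).measurable

/-- The first two conclusions say that the relativization of `A` and the restriction maps
are well defined; the last one is the ultraweak convergence. -/
theorem theorem3p1
    {G : Type*} [Group G] [TopologicalSpace G] [IsTopologicalGroup G] [LocallyCompactSpace G]
    [SecondCountableTopology G] [MeasurableSpace G] [BorelSpace G]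
    {HR : Type*} [NormedAddCommGroup HR] [InnerProductSpace ℂ HR] [CompleteSpace HR]
    [TopologicalSpace.SeparableSpace HR]
    {HS : Type*} [NormedAddCommGroup HS] [InnerProductSpace ℂ HS] [CompleteSpace HS]
    [TopologicalSpace.SeparableSpace HS]
    (R : QRF.PrincipalFrame G HR) (hR : R.obs.IsLocalizable)
    (U : QRF.UnitaryRep G HS)
    (ω : ℕ → HR →L[ℂ] HR) (hω : R.obs.IsLocalizingSequence 1 ω)
    (A : HS →L[ℂ] HS) :
    (∃! Y, QRF.IsRelativization R U A Y) ∧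
    (∀ (n : ℕ) (T : QRF.HilbertTensor HR HS →L[ℂ] QRF.HilbertTensor HR HS),
      ∃! B : HS →L[ℂ] HS, QRF.IsRestriction (ω n) T B) ∧
    QRF.UltraweakTendsto (fun n => QRF.restriction (ω n) (QRF.relativization R U A)) A := by
  obtain ⟨hY, hB, h_lim⟩ := theorem3p1_general hω (fun g => (U.norm_act g A).le)
    (U.continuous_inner_act A)
  exact ⟨hY, hB, by
    simpa only [U.act_one] using h_lim _ (QRF.isRelativization_relativization hY.exists)⟩
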